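/- Let $F_n$ be the free group of rank $n$, with lower central series $F_{n,0}=F_n$, $F_{n,k+1}=[F_{n,k},F_n]$. For a group $\Gamma$ let $d_2(\Gamma)\in\{0,1,2,\dots\}\cup\{\infty\}$ be the largest $n\ge 0$ for which there is an epimorphism $\Gamma\to F_n/F_{n,2}$. Call classes $v_1,\dots,v_n\in H^1(\Gamma,\mathbb Z)$ (trivial coefficients) primitive if the homomorphism $(v_1,\dots,v_n):H_1(\Gamma,\mathbb Z)\to\mathbb Z^n$ given by evaluation is surjective, and let $c_2(\Gamma)\in\{0,1,2,\dots\}\cup\{\infty\}$ be the largest $n\ge 0$ for which there are primitive classes $v_1,\dots,v_n\in H^1(\Gamma,\mathbb Z)$ with $v_i\cup v_j=0$ in $H^2(\Gamma,\mathbb Z)$ for all $i,j$. (Each number is $\infty$ if arbitrarily large $n$ occur.) Then, for every group $\Gamma$, $$d_2(\Gamma)=c_2(\Gamma).$$ -/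

import Mathlib

noncomputable section

open scoped TensorProduct

universe u

/-- The `k`-th term `F_{n,k}` of the lower central series of the free group `F_n`, indexed so that
`F_{n,0} = F_n` and `F_{n,k+1} = [F_{n,k}, F_n]`. -/
abbrev freeLCS (n k : ℕ) : Subgroup (FreeGroup (Fin n)) :=
  (⊤ : Subgroup (FreeGroup (Fin n))).lowerCentralSeries k

/-- There is an epimorphism from `Γ` onto `F_n / F_{n,k}`, the free nilpotent group of class `k`
on `n` generators. -/
def MapsOntoFreeNilpotent (Γ : Type u) [Group Γ] (k n : ℕ) : Prop :=
  ∃ f : Γ →* FreeGroup (Fin n) ⧸ freeLCS n k, Function.Surjective f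

/-- `d_k(Γ)`: the largest `n` such that `Γ` maps onto `F_n / F_{n,k}`, as an element of `ℕ∞`.
It is `⊤` when there are arbitrarily large such `n`; the value `n = 0` is always allowed. -/
def dNumber (k : ℕ) (Γ : Type u) [Group Γ] : ℕ∞ :=
  ⨆ (n : ℕ) (_ : MapsOntoFreeNilpotent Γ k n), (n : ℕ∞)

/-- The trivial `Γ`-module `ℤ`. The ring `ℤ` is lifted to the universe of `Γ`, as Mathlib's group
(co)homology asks for. -/
abbrev trivialZ (Γ : Type u) [Group Γ] : Rep.{u} (ULift.{u} ℤ) Γ :=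
  Rep.trivial (ULift.{u} ℤ) Γ (ULift.{u} ℤ)

/-- The integral homology group `H_1(Γ, ℤ)`. -/
abbrev HomologyOne (Γ : Type u) [Group Γ] : Type u := groupHomology.H1 (trivialZ Γ)

/-- The integral cohomology group `H^1(Γ, ℤ)`. -/
abbrev CohomologyOne (Γ : Type u) [Group Γ] : Type u := groupCohomology.H1 (trivialZ Γ)

/-- The integral cohomology group `H^2(Γ, ℤ)`. -/
abbrev CohomologyTwo (Γ : Type u) [Group Γ] : Type u := groupCohomology.H2 (trivialZ Γ)

variable {Γ : Type u} [Group Γ]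

/-- The homomorphism `Γ → ℤ` that a class in `H^1(Γ, ℤ)` is: as the action is trivial, this is the
unique `1`-cocycle in the class. -/
def CohomologyOne.toHom (v : CohomologyOne Γ) : Additive Γ →+ ULift.{u} ℤ :=
  (groupCohomology.H1IsoOfIsTrivial (trivialZ Γ)).hom v

theorem CohomologyOne.toHom_mk (f : groupCohomology.cocycles₁ (trivialZ Γ)) (g : Γ) :
    CohomologyOne.toHom (groupCohomology.H1π (trivialZ Γ) f) (Additive.ofMul g) = f g :=
  groupCohomology.H1IsoOfIsTrivial_H1π_apply_apply f (Additive.ofMul g)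

/-- The Kronecker pairing `H^1(Γ, ℤ) × H_1(Γ, ℤ) → ℤ`, `⟨v, [γ ⊗ a]⟩ = v(γ) a`, through Mathlib's
identification of `H_1(Γ, ℤ)` with `Γᵃᵇ ⊗ ℤ`. -/
def kronecker (v : CohomologyOne Γ) : HomologyOne Γ →+ ℤ :=
  (AddEquiv.ulift.toAddMonoidHom.comp
    (TensorProduct.lift
      ((LinearMap.mul ℤ (ULift.{u} ℤ)).comp
        (MonoidHom.toAdditiveLeft (Abelianization.lift
          (AddMonoidHom.toMultiplicativeRight v.toHom))).toIntLinearMap)).toAddMonoidHom).comp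
    (groupHomology.H1ToTensorOfIsTrivial (trivialZ Γ)).toAddMonoidHom

/-- On cycles, the Kronecker pairing evaluates the cocycle on the cycle. -/
theorem kronecker_mk (v : CohomologyOne Γ) (γ : Γ) (a : ULift.{u} ℤ) :
    kronecker v (groupHomology.H1π (trivialZ Γ)
      ((groupHomology.cycles₁IsoOfIsTrivial (trivialZ Γ)).inv (Finsupp.single γ a))) =
      (v.toHom (Additive.ofMul γ)).down * a.down := by
  have h := groupHomology.H1ToTensorOfIsTrivial_H1π_single (A := trivialZ Γ) γ a
  simp only [kronecker, AddMonoidHom.comp_apply, LinearMap.toAddMonoidHom_coe]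
  erw [h]
  rfl

/-- A family `v_1, …, v_n` in `H^1(Γ, ℤ)` is primitive if the map
`(v_1, …, v_n) : H_1(Γ, ℤ) → ℤⁿ` is onto. -/
def IsPrimitiveFamily {n : ℕ} (v : Fin n → CohomologyOne Γ) : Prop :=
  Function.Surjective fun (x : HomologyOne Γ) (i : Fin n) => kronecker (v i) x

/-- The cochain `(x, y) ↦ -f(x) g(y)` attached to two homomorphisms `f, g : Γ → ℤ` is a
`2`-cocycle. -/
def cupCocycle (f g : Additive Γ →+ ULift.{u} ℤ) : groupCohomology.cocycles₂ (trivialZ Γ) :=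
  ⟨fun p => -(f (Additive.ofMul p.1) * g (Additive.ofMul p.2)), by
    rw [groupCohomology.mem_cocycles₂_iff]
    intro a b c
    simp only [ofMul_mul, map_add, Representation.isTrivial_def, LinearMap.id_apply]
    ring⟩

/-- The cup product `H^1(Γ, ℤ) × H^1(Γ, ℤ) → H^2(Γ, ℤ)`, induced on inhomogeneous cochains by
`(f ∪ g)(x, y) = -f(x) g(y)` (the usual sign `(-1)^{pq}` for classes of degrees `p = q = 1`). -/
def cup (v w : CohomologyOne Γ) : CohomologyTwo Γ :=
  groupCohomology.H2π (trivialZ Γ) (cupCocycle v.toHom w.toHom)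

/-- `Γ` has a primitive family `v_1, …, v_n` in `H^1(Γ, ℤ)` with `v_i ∪ v_j = 0` for all `i, j`. -/
def HasPrimitiveCupZero (Γ : Type u) [Group Γ] (n : ℕ) : Prop :=
  ∃ v : Fin n → CohomologyOne Γ, IsPrimitiveFamily v ∧ ∀ i j, cup (v i) (v j) = 0

/-- `c_2(Γ)`, the algebraic cut number: the largest `n` for which there is a primitive set
`v_1, …, v_n` in `H^1(Γ, ℤ)` with all `v_i ∪ v_j = 0`, as an element of `ℕ∞` (the members of a
primitive family are pairwise distinct). It is `⊤` when there are arbitrarily large such `n`; the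
value `n = 0` is always allowed. -/
def cTwo (Γ : Type u) [Group Γ] : ℕ∞ :=
  ⨆ (n : ℕ) (_ : HasPrimitiveCupZero Γ n), (n : ℕ∞)

end

/-
A homomorphism `f : Γ → ℤⁿ` with pairwise vanishing cup products lifts to every group `Q` of class
two with generators `x_1, …, x_n`: one looks for the lift in the form
`x_n ^ f_n(g) ⋯ x_1 ^ f_1(g) · z(g)` with `z` central, and the bilinearity of the commutator turns
multiplicativity into the condition that `z` bounds a product of the cocycles `f_i ∪ f_j` with
coefficients `[x_i, x_j]`. A lift of a surjective `f` is surjective because a subgroup of a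
nilpotent group that generates it modulo commutators is everything. Conversely, the Magnus
expansion `x_i ↦ 1 + X_i`, truncated in degree three, factors through `F_n / F_{n,2}`; its
coefficients at `X_i` are the exponent sums, and its coefficient at `X_i X_j` is a cochain bounding
the cup product of the exponent sums of `x_i` and `x_j`.
-/

open Subgroup
open scoped commutatorElement IsMulCommutative TensorProduct

universe u

noncomputable section

section Homology

variable {Γ : Type u} [Group Γ]

/-- The class of a group element in `H_1(Γ, ℤ)`, represented by the cycle `[g]`. -/
def homologyClass (g : Γ) : HomologyOne Γ :=
  groupHomology.H1π (trivialZ Γ)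
    ((groupHomology.cycles₁IsoOfIsTrivial (trivialZ Γ)).inv (Finsupp.single g 1))

theorem tmul_one_surjective (M : Type*) [AddCommGroup M] :
    Function.Surjective fun m : M => m ⊗ₜ[ℤ] (1 : ULift.{u} ℤ) :=
  ((TensorProduct.rid ℤ M).symm ≪≫ₗ
    TensorProduct.congr (.refl ℤ M) ULift.moduleEquiv.symm).surjective

theorem homologyClass_surjective : Function.Surjective (homologyClass (Γ := Γ)) := by
  intro x
  obtain ⟨m, hm⟩ := tmul_one_surjective _ (groupHomology.H1AddEquivOfIsTrivial (trivialZ Γ) x)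
  obtain ⟨g, hg⟩ := QuotientGroup.mk_surjective m.toMul
  refine ⟨g, (groupHomology.H1AddEquivOfIsTrivial (trivialZ Γ)).injective ?_⟩
  rw [← hm, homologyClass, groupHomology.H1AddEquivOfIsTrivial_single]
  exact congrArg (fun a => Additive.ofMul a ⊗ₜ[ℤ] (1 : ULift.{u} ℤ)) hg

theorem kronecker_homologyClass (v : CohomologyOne Γ) (g : Γ) :
    kronecker v (homologyClass g) = (v.toHom (Additive.ofMul g)).down :=
  (kronecker_mk v g 1).trans (mul_one _)

theorem isPrimitiveFamily_iff {n : ℕ} (v : Fin n → CohomologyOne Γ) :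
    IsPrimitiveFamily v ↔
      Function.Surjective fun (g : Γ) (i : Fin n) => ((v i).toHom (Additive.ofMul g)).down := by
  rw [IsPrimitiveFamily, ← homologyClass_surjective.of_comp_iff]
  simp only [Function.comp_def, kronecker_homologyClass]

end Homology

section Cup

variable {Γ : Type u} [Group Γ]

/-- The cup product of two homomorphisms `f₁, f₂ : Γ → R` vanishes in `H^2(Γ, R)`: the cocycle
`(g, h) ↦ f₁(g) f₂(h)` is the coboundary of `-c` for a function `c`. -/
def IsCupTrivial {R : Type*} [Ring R] (f₁ f₂ : Additive Γ →+ R) : Prop :=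
  ∃ c : Γ → R, ∀ g h, c (g * h) = c g + c h + f₁ (Additive.ofMul g) * f₂ (Additive.ofMul h)

theorem IsCupTrivial.comp {R G : Type*} [Ring R] [Group G] {f₁ f₂ : Additive G →+ R}
    (hf : IsCupTrivial f₁ f₂) (φ : Γ →* G) :
    IsCupTrivial (f₁.comp φ.toAdditive) (f₂.comp φ.toAdditive) := by
  obtain ⟨c, hc⟩ := hf
  exact ⟨c ∘ φ, fun g h => by simp [hc]⟩

/-- A class in `H^1(Γ, ℤ)` as a homomorphism to `ℤ`, without the universe lift. -/
def CohomologyOne.equivHom : CohomologyOne Γ ≃ (Additive Γ →+ ℤ) :=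
  (groupCohomology.H1IsoOfIsTrivial (trivialZ Γ)).toLinearEquiv.toEquiv.trans
    (AddEquiv.ulift.addMonoidHomCongrRight (M := Additive Γ)).toEquiv

theorem CohomologyOne.equivHom_apply (v : CohomologyOne Γ) (g : Additive Γ) :
    equivHom v g = (v.toHom g).down :=
  rfl

theorem cup_eq_zero_iff (v w : CohomologyOne Γ) :
    cup v w = 0 ↔ IsCupTrivial v.equivHom w.equivHom := by
  rw [cup, groupCohomology.H2π_eq_zero_iff]
  constructor
  · rintro ⟨c, hc⟩
    refine ⟨fun g => (c g).down, fun g h => ?_⟩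
    have hcgh : (c h).down - (c (g * h)).down + (c g).down =
        -(v.equivHom (Additive.ofMul g) * w.equivHom (Additive.ofMul h)) :=
      congrArg ULift.down (congrFun hc (g, h))
    linarith
  · rintro ⟨c, hc⟩
    refine ⟨fun g => ⟨c g⟩, funext fun ⟨g, h⟩ => ULift.ext _ _ ?_⟩
    change c h - c (g * h) + c g =
      -(v.equivHom (Additive.ofMul g) * w.equivHom (Additive.ofMul h))
    rw [hc]
    ring

theorem hasPrimitiveCupZero_iff {n : ℕ} :
    HasPrimitiveCupZero Γ n ↔ ∃ f : Fin n → Additive Γ →+ ℤ,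
      (Function.Surjective fun (g : Γ) (i : Fin n) => f i (Additive.ofMul g)) ∧
        ∀ i j, IsCupTrivial (f i) (f j) := by
  rw [HasPrimitiveCupZero, ((Equiv.refl (Fin n)).arrowCongr
    (CohomologyOne.equivHom (Γ := Γ))).exists_congr_left]
  simp [isPrimitiveFamily_iff, cup_eq_zero_iff, ← CohomologyOne.equivHom_apply]

end Cup

section Nilpotent

variable {G : Type*} [Group G]

theorem commutator_le_of_sup_center_eq_top {H : Subgroup G} (h : H ⊔ center G = ⊤) :
    commutator G ≤ H := by
  have : H.Normal := normalizer_eq_top_iff.1 <|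
    top_le_iff.1 <| h ▸ sup_le le_normalizer (center_le_normalizer _)
  exact this.commutator_le_of_self_sup_commutative_eq_top h inferInstance

theorem eq_top_of_sup_commutator_eq_top [Group.IsNilpotent G] {H : Subgroup G}
    (h : H ⊔ commutator G = ⊤) : H = ⊤ := by
  revert H
  refine Group.nilpotent_center_quotient_ind
    (P := fun G _ _ => ∀ {H : Subgroup G}, H ⊔ commutator G = ⊤ → H = ⊤) G
    (fun _ _ _ _ _ => Subsingleton.elim _ _) fun G _ _ ih H h => ?_
  have hmap : H.map (QuotientGroup.mk' (center G)) = ⊤ := by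
    refine ih ?_
    rw [← map_top_of_surjective _ (QuotientGroup.mk'_surjective (center G)), commutator_def,
      ← map_top_of_surjective _ (QuotientGroup.mk'_surjective (center G)), ← map_commutator,
      ← commutator_def, ← Subgroup.map_sup, h]
  have hcenter : H ⊔ center G = ⊤ := by
    rw [← QuotientGroup.ker_mk' (center G), ← comap_map_eq, hmap, comap_top]
  rwa [sup_eq_left.2 (commutator_le_of_sup_center_eq_top hcenter)] at h

theorem top_lowerCentralSeries_two_eq_bot_iff :
    (⊤ : Subgroup G).lowerCentralSeries 2 = ⊥ ↔ commutator G ≤ center G :=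
  commutator_top_right_eq_bot_iff_le_center

theorem isNilpotent_of_commutator_le_center (hG : commutator G ≤ center G) :
    Group.IsNilpotent G :=
  Subgroup.nilpotent_iff_lowerCentralSeries.2 ⟨2, top_lowerCentralSeries_two_eq_bot_iff.2 hG⟩

theorem commutator_le_center_quotient_lowerCentralSeries_two :
    commutator (G ⧸ (⊤ : Subgroup G).lowerCentralSeries 2) ≤ center _ := by
  rw [← top_lowerCentralSeries_two_eq_bot_iff,
    ← map_top_of_surjective _ (QuotientGroup.mk'_surjective _), ← map_lowerCentralSeries,
    Subgroup.map_eq_bot_iff, QuotientGroup.ker_mk']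

end Nilpotent

section ClassTwo

variable {G : Type*} [Group G]

theorem commutatorElement_mul_left {a b c : G} (h : ⁅b, c⁆ ∈ center G) :
    ⁅a * b, c⁆ = ⁅a, c⁆ * ⁅b, c⁆ := by
  rw [commutatorElement_mul_left_eq_conj_mul, mem_center_iff.1 h a, mul_inv_cancel_right,
    mem_center_iff.1 h]

theorem commutatorElement_mul_right {a b c : G} (h : ⁅a, c⁆ ∈ center G) :
    ⁅a, b * c⁆ = ⁅a, b⁆ * ⁅a, c⁆ := by
  rw [commutatorElement_mul_right_eq_mul_conj, mul_assoc _ b, mem_center_iff.1 h b, ← mul_assoc,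
    mul_inv_cancel_right]

/-- The bilinear pairing `(a, b) ↦ [a, b]` on the abelianization of a group of class at most two,
with values in the center. -/
def commutatorPairing (hG : commutator G ≤ center G) :
    Abelianization G →* Abelianization G →* center G :=
  have hmem (a b : G) : ⁅a, b⁆ ∈ center G := commutator_le.1 hG a (mem_top a) b (mem_top b)
  Abelianization.lift <| MonoidHom.mk'
    (fun a => Abelianization.lift <| MonoidHom.mk' (fun b => ⟨⁅a, b⁆, hmem a b⟩)
      fun _ c => Subtype.ext <| commutatorElement_mul_right (hmem a c))
    fun _ b => Abelianization.hom_ext _ _ <| MonoidHom.ext fun c =>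
      Subtype.ext <| commutatorElement_mul_left (hmem b c)

theorem abelianization_of_commutatorPairing (hG : commutator G ≤ center G)
    (a b : Abelianization G) : Abelianization.of (commutatorPairing hG a b : G) = 1 := by
  obtain ⟨a, rfl⟩ := QuotientGroup.mk_surjective a
  obtain ⟨b, rfl⟩ := QuotientGroup.mk_surjective b
  exact (map_commutatorElement _ a b).trans (Commute.all _ _).commutator_eq

variable {Γ : Type*} [Group Γ]

/-- The homomorphism `g ↦ χ(g) ψ(g) z(g)`, where the central factor `z` makes up for the
commutators that prevent `χ ψ` from being multiplicative. -/
def centralTwist (χ ψ : Γ →* G) (z : Γ → center G)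
    (hz : ∀ g h, (z (g * h) : G) = z g * z h * ⁅ψ g, χ h⁆) : Γ →* G :=
  MonoidHom.mk' (fun g => χ g * ψ g * z g) fun g h => by
    have hcenter : ⁅ψ g, χ h⁆ ∈ center G :=
      (mul_mem_cancel_left (mul_mem (z g).2 (z h).2)).1 (hz g h ▸ (z (g * h)).2)
    have hz_comm : Commute (z g : G) (χ h * ψ h) := (mem_center_iff.1 (z g).2 _).symm
    have hcomm : Commute ⁅ψ g, χ h⁆ (χ h * ψ g * ψ h) := (mem_center_iff.1 hcenter _).symm
    have hz_comm' : Commute ⁅ψ g, χ h⁆ (z g * z h) := (mem_center_iff.1 hcenter _).symm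
    calc χ (g * h) * ψ (g * h) * z (g * h)
        = χ g * (χ h * ψ g * ψ h * ⁅ψ g, χ h⁆) * (z g * z h) := by
          simp only [map_mul, hz, ← hz_comm'.eq, mul_assoc]
      _ = χ g * ψ g * (χ h * ψ h) * (z g * z h) := by
          rw [← hcomm.eq]
          simp only [commutatorElement_def, mul_assoc, inv_mul_cancel_left]
      _ = χ g * ψ g * z g * (χ h * ψ h * z h) := (hz_comm.mul_mul_mul_comm _ _).symm

theorem exists_hom_abelianization_eq_prod (hG : commutator G ≤ center G) {ι : Type*} (x : ι → G)
    {f : ι → Additive Γ →+ ℤ} (hf : ∀ i j, IsCupTrivial (f i) (f j)) (S : Finset ι) :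
    ∃ ψ : Γ →* G, ∀ g,
      Abelianization.of (ψ g) = ∏ i ∈ S, Abelianization.of (x i) ^ f i (Additive.ofMul g) := by
  classical
  induction S using Finset.induction_on with
  | empty => exact ⟨1, fun g => by simp⟩
  | insert j S hj ih =>
    obtain ⟨ψ, hψ⟩ := ih
    choose c hc using fun i => hf i j
    let z (g : Γ) : center G := ∏ i ∈ S,
      commutatorPairing hG (Abelianization.of (x i)) (Abelianization.of (x j)) ^ c i g
    let χ : Γ →* G := (zpowersHom G (x j)).comp (AddMonoidHom.toMultiplicativeRight (f j))
    have hχ (g : Γ) : χ g = x j ^ f j (Additive.ofMul g) := rfl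
    have hz (g h : Γ) : z (g * h) = z g * z h *
        commutatorPairing hG (Abelianization.of (ψ g)) (Abelianization.of (χ h)) := by
      simp only [z, hψ, hχ, hc, zpow_add, zpow_mul, Finset.prod_mul_distrib, Finset.prod_zpow,
        map_prod, map_zpow, MonoidHom.finsetProd_apply, MonoidHom.zpow_apply]
    have hz_ab (g : Γ) : Abelianization.of (z g : G) = 1 := by
      change (Abelianization.of.comp (center G).subtype) (z g) = 1
      simp only [z, map_prod, map_zpow, MonoidHom.comp_apply, subtype_apply,
        abelianization_of_commutatorPairing, one_zpow, Finset.prod_const_one]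
    refine ⟨centralTwist χ ψ z fun g h => congrArg Subtype.val (hz g h), fun g => ?_⟩
    simp [centralTwist, hψ, hχ, hz_ab, Finset.prod_insert hj]

theorem exists_surjective_hom_of_isCupTrivial (hG : commutator G ≤ center G) {ι : Type*}
    [Finite ι] {x : ι → G} (hx : closure (Set.range x) = ⊤) {f : ι → Additive Γ →+ ℤ}
    (hf : Function.Surjective fun (g : Γ) i => f i (Additive.ofMul g))
    (hcup : ∀ i j, IsCupTrivial (f i) (f j)) : ∃ ψ : Γ →* G, Function.Surjective ψ := by
  classical
  cases nonempty_fintype ι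
  have := isNilpotent_of_commutator_le_center hG
  obtain ⟨ψ, hψ⟩ := exists_hom_abelianization_eq_prod hG x hcup Finset.univ
  refine ⟨ψ, MonoidHom.range_eq_top.1 <| eq_top_of_sup_commutator_eq_top <| top_le_iff.1 ?_⟩
  rw [← hx, closure_le]
  rintro _ ⟨i, rfl⟩
  obtain ⟨g, hg⟩ := hf (Pi.single i 1)
  have hgi : Abelianization.of (ψ g) = Abelianization.of (x i) := by
    simp [hψ, congrFun hg, Pi.single_apply]
  have hmem : (ψ g)⁻¹ * x i ∈ commutator G := QuotientGroup.eq.1 hgi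
  exact mul_inv_cancel_left (ψ g) (x i) ▸ mul_mem_sup ⟨g, rfl⟩ hmem

end ClassTwo

section Magnus

/-- The units `1 + ∑ a_i X_i + ∑ b_ij X_i X_j` of the ring of noncommutative power series over `R`
in variables `X_i`, modulo the terms of degree at least three. -/
@[ext]
structure TruncatedMagnus (ι R : Type*) where
  /-- The coefficients `a_i`. -/
  lin : ι → R
  /-- The coefficients `b_ij`. -/
  quad : ι → ι → R

namespace TruncatedMagnus

variable {ι R : Type*} [Ring R]

instance : Mul (TruncatedMagnus ι R) :=
  ⟨fun u v => ⟨u.lin + v.lin, fun i j => u.quad i j + v.quad i j + u.lin i * v.lin j⟩⟩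

instance : One (TruncatedMagnus ι R) := ⟨⟨0, 0⟩⟩

instance : Inv (TruncatedMagnus ι R) :=
  ⟨fun u => ⟨-u.lin, fun i j => -u.quad i j + u.lin i * u.lin j⟩⟩

@[simp] theorem lin_mul (u v : TruncatedMagnus ι R) : (u * v).lin = u.lin + v.lin := rfl

@[simp] theorem quad_mul (u v : TruncatedMagnus ι R) (i j : ι) :
    (u * v).quad i j = u.quad i j + v.quad i j + u.lin i * v.lin j := rfl

@[simp] theorem lin_one : (1 : TruncatedMagnus ι R).lin = 0 := rfl

@[simp] theorem quad_one : (1 : TruncatedMagnus ι R).quad = 0 := rfl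

@[simp] theorem lin_inv (u : TruncatedMagnus ι R) : u⁻¹.lin = -u.lin := rfl

@[simp] theorem quad_inv (u : TruncatedMagnus ι R) (i j : ι) :
    u⁻¹.quad i j = -u.quad i j + u.lin i * u.lin j := rfl

instance : Group (TruncatedMagnus ι R) :=
  Group.ofLeftAxioms
    (fun u v w => by ext <;> simp only [lin_mul, quad_mul, Pi.add_apply, add_mul, mul_add] <;> abel)
    (fun u => by ext <;> simp)
    (fun u => by ext <;> simp)

/-- The coefficient at `X_i`, as a homomorphism. -/
def linHom (i : ι) : Additive (TruncatedMagnus ι R) →+ R where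
  toFun u := u.toMul.lin i
  map_zero' := rfl
  map_add' _ _ := rfl

theorem isCupTrivial_linHom (i j : ι) :
    IsCupTrivial (linHom i : Additive (TruncatedMagnus ι R) →+ R) (linHom j) :=
  ⟨fun u => u.quad i j, fun u v => quad_mul u v i j⟩

theorem mem_center_of_lin_eq_zero {u : TruncatedMagnus ι R} (hu : u.lin = 0) :
    u ∈ center (TruncatedMagnus ι R) :=
  mem_center_iff.2 fun v => by ext <;> simp [hu, add_comm]

theorem commutator_le_center :
    commutator (TruncatedMagnus ι R) ≤ center (TruncatedMagnus ι R) :=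
  commutator_le.2 fun u _ v _ => mem_center_of_lin_eq_zero <| by simp [commutatorElement_def]

variable (ι R) in
/-- The Magnus expansion `x_i ↦ 1 + X_i`, truncated in degree three. -/
def expansion [DecidableEq ι] : FreeGroup ι →* TruncatedMagnus ι R :=
  FreeGroup.lift fun i => ⟨Pi.single i 1, 0⟩

variable (ι R) in
/-- The truncated Magnus expansion on the free group of class two. -/
def quotientExpansion [DecidableEq ι] :
    FreeGroup ι ⧸ (⊤ : Subgroup (FreeGroup ι)).lowerCentralSeries 2 →* TruncatedMagnus ι R :=
  QuotientGroup.lift _ (expansion ι R) <| (Subgroup.map_eq_bot_iff _).1 <| le_bot_iff.1 <| by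
    rw [map_lowerCentralSeries, ← top_lowerCentralSeries_two_eq_bot_iff.2 commutator_le_center]
    exact lowerCentralSeries_mono 2 le_top

theorem lin_quotientExpansion_of [DecidableEq ι] (i : ι) :
    (quotientExpansion ι R (QuotientGroup.mk (FreeGroup.of i))).lin = Pi.single i 1 :=
  congrArg lin FreeGroup.lift_apply_of

theorem lin_quotientExpansion_surjective [DecidableEq ι] [Finite ι] :
    Function.Surjective fun w => (quotientExpansion ι ℤ w).lin := by
  cases nonempty_fintype ι
  let L : Additive (FreeGroup ι ⧸ (⊤ : Subgroup (FreeGroup ι)).lowerCentralSeries 2) →+ (ι → ℤ) :=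
    (AddMonoidHom.pi linHom).comp (quotientExpansion ι ℤ).toAdditive
  have hL (i : ι) : Pi.single i 1 ∈ L.range :=
    ⟨Additive.ofMul (QuotientGroup.mk (FreeGroup.of i)),
      lin_quotientExpansion_of (R := ℤ) i⟩
  intro e
  suffices e ∈ L.range from this
  rw [← Finset.univ_sum_single e]
  refine sum_mem fun i _ => ?_
  simpa [← Pi.single_smul'] using zsmul_mem (hL i) (e i)

end TruncatedMagnus

end Magnus

theorem hasPrimitiveCupZero_of_mapsOntoFreeNilpotent {Γ : Type u} [Group Γ] {n : ℕ}
    (h : MapsOntoFreeNilpotent Γ 2 n) : HasPrimitiveCupZero Γ n := by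
  obtain ⟨φ, hφ⟩ := h
  let ψ : Γ →* TruncatedMagnus (Fin n) ℤ := (TruncatedMagnus.quotientExpansion (Fin n) ℤ).comp φ
  exact hasPrimitiveCupZero_iff.2 ⟨fun i => (TruncatedMagnus.linHom i).comp ψ.toAdditive,
    TruncatedMagnus.lin_quotientExpansion_surjective.comp hφ,
    fun i j => (TruncatedMagnus.isCupTrivial_linHom i j).comp ψ⟩

theorem mapsOntoFreeNilpotent_of_hasPrimitiveCupZero {Γ : Type u} [Group Γ] {n : ℕ}
    (h : HasPrimitiveCupZero Γ n) : MapsOntoFreeNilpotent Γ 2 n := by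
  obtain ⟨f, hf, hcup⟩ := hasPrimitiveCupZero_iff.1 h
  have hgen : closure (Set.range fun i : Fin n =>
      (QuotientGroup.mk' (freeLCS n 2)) (FreeGroup.of i)) = ⊤ := by
    rw [Set.range_comp', ← MonoidHom.map_closure, FreeGroup.closure_range_of,
      map_top_of_surjective _ (QuotientGroup.mk'_surjective _)]
  exact exists_surjective_hom_of_isCupTrivial
    commutator_le_center_quotient_lowerCentralSeries_two hgen hf hcup

end

theorem mainTheorem5 (Γ : Type*) [Group Γ] : dNumber 2 Γ = cTwo Γ := by
  have h (n : ℕ) : MapsOntoFreeNilpotent Γ 2 n ↔ HasPrimitiveCupZero Γ n :=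
    ⟨hasPrimitiveCupZero_of_mapsOntoFreeNilpotent, mapsOntoFreeNilpotent_of_hasPrimitiveCupZero⟩
  simp only [dNumber, cTwo, h]
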